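/- Let $\mathbb K=\mathbb R$ or $\mathbb C$, let $n\ge 2$, let $E_1,\dots,E_n,F$ be Banach spaces over $\mathbb K$ and let $A\colon E_1\times\cdots\times E_n\to F$ be a continuous $n$-linear operator. For a finite sequence $(x_j)_{j=1}^k$ in a Banach space put $\|(x_j)_{j=1}^k\|_p=\big(\sum_{j=1}^k\|x_j\|^p\big)^{1/p}$ for $0<p<\infty$, and $\|(x_j)_{j=1}^k\|_{\mathrm{Rad}}=\big(\int_0^1\|\sum_{j=1}^k r_j(t)x_j\|^2\,dt\big)^{1/2}$, where $r_j(t)=\operatorname{sign}(\sin(2^j\pi t))$ are the Rademacher functions. For $0<p_1,\dots,p_n,q<\infty$, a continuous $n$-linear operator $T$ on $G_1\times\cdots\times G_n$ ($G_i$ Banach spaces) has *type* $(p_1,\dots,p_n)$ if there is $C>0$ such that $$\big\|\big(T(x^{(1)}_j,\dots,x^{(n)}_j)\big)_{j=1}^k\big\|_{\mathrm{Rad}}\le C\prod_{i=1}^n\|(x^{(i)}_j)_{j=1}^k\|_{p_i}$$ for all $k$ and all $x^{(i)}_1,\dots,x^{(i)}_k\in G_i$, $i=1,\dots,n$; it has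 *cotype* $q$ if there is $M>0$ such that $$\big\|\big(T(x^{(1)}_j,\dots,x^{(n)}_j)\big)_{j=1}^k\big\|_{q}\le M\prod_{i=1}^n\|(x^{(i)}_j)_{j=1}^k\|_{\mathrm{Rad}}$$ for all such choices. The tuple $(p_1,\dots,p_n)$ is a *proper type* if $\frac12\le\frac1{p_1}+\cdots+\frac1{p_n}<1$, and $q$ is a *proper cotype* if $\frac2n\le q<\infty$. Write $J_G\colon G\to G''$ for the canonical embedding into the bidual. For a permutation $\sigma$ of $\{1,\dots,n\}$, the *Aron–Berner extension* of $A$ in the order $\sigma$ is the continuous $n$-linear operator $E_1''\times\cdots\times E_n''\to F''$ that sends $(y_1,\dots,y_n)$ to the iterated weak-star limit $$\underset{\alpha_{\sigma(1)}}{w^*\text{-}\lim}\cdots\underset{\alpha_{\sigma(n)}}{w^*\text{-}\lim}\;J_F\big(A(x_{\alpha_1},\dots,x_{\alpha_n})\big),$$ where, for each $i$, $(x_{\alpha_i})$ is any net in $E_i$ such that $J_{E_i}(x_{\alpha_i})\to y_i$ weak-star; the limit does not depend on the choice of these nets. Thus $A$ has at most $n!$ different Aron–Berner extensions. **Corollary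 4.2.** Let $(p_1,\dots,p_n)$ be a proper type and let $q$ be a proper cotype. The following are equivalent: (a) $A$ has type $(p_1,\dots,p_n)$; (b) all Aron–Berner extensions of $A$ have type $(p_1,\dots,p_n)$; (c) some Aron–Berner extension of $A$ has type $(p_1,\dots,p_n)$. The same equivalence holds with "type $(p_1,\dots,p_n)$" replaced by "cotype $q$" throughout (a), (b), (c). -/

import Mathlib

open Filter Topology

noncomputable section

/-- The Rademacher functions `r₁, r₂, …` on `[0,1]`, with `rademacher j` standing for `r_{j+1}`:
`r_{j+1}(t) = sign (sin (2^{j+1} π t))`. -/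
def rademacher (j : ℕ) (t : ℝ) : ℝ :=
  Real.sign (Real.sin (2 ^ (j + 1) * Real.pi * t))

/-- The norm of a finite sequence in `Rad(E)`:
`(∫₀¹ ‖∑ⱼ rⱼ(t) xⱼ‖² dt)^{1/2}`. -/
def radNorm (𝕜 : Type*) [RCLike 𝕜] {E : Type*} [NormedAddCommGroup E] [NormedSpace 𝕜 E]
    {k : ℕ} (x : Fin k → E) : ℝ :=
  Real.sqrt (∫ t in (0 : ℝ)..1, ‖∑ j : Fin k, ((rademacher j t : ℝ) : 𝕜) • x j‖ ^ 2)

/-- The `ℓ_p`-(quasi-)norm of a finite sequence, for `0 < p < ∞`. -/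
def lpSeqNorm {E : Type*} [NormedAddCommGroup E] (p : ℝ) {k : ℕ} (x : Fin k → E) : ℝ :=
  (∑ j : Fin k, ‖x j‖ ^ p) ^ (1 / p)

section TypeCotype

variable {𝕜 : Type*} [RCLike 𝕜] {n : ℕ}
  {E : Fin n → Type*} [∀ i, NormedAddCommGroup (E i)] [∀ i, NormedSpace 𝕜 (E i)]
  {F : Type*} [NormedAddCommGroup F] [NormedSpace 𝕜 F]

/-- `T` has type `(p₁, …, pₙ)`. -/
def HasMultiType (p : Fin n → ℝ) (T : ContinuousMultilinearMap 𝕜 E F) : Prop :=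
  ∃ C : ℝ, 0 < C ∧ ∀ (k : ℕ) (x : ∀ i, Fin k → E i),
    radNorm 𝕜 (fun j => T (fun i => x i j)) ≤ C * ∏ i, lpSeqNorm (p i) (x i)

/-- `T` has cotype `q`. -/
def HasMultiCotype (q : ℝ) (T : ContinuousMultilinearMap 𝕜 E F) : Prop :=
  ∃ M : ℝ, 0 < M ∧ ∀ (k : ℕ) (x : ∀ i, Fin k → E i),
    lpSeqNorm q (fun j => T (fun i => x i j)) ≤ M * ∏ i, radNorm 𝕜 (x i)

end TypeCotype

/-- `(p₁, …, pₙ)`, with `0 < pᵢ < ∞`, is a proper type for `n`-linear operators. -/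
def IsProperType {n : ℕ} (p : Fin n → ℝ) : Prop :=
  (∀ i, 0 < p i) ∧ 1 / 2 ≤ ∑ i, 1 / p i ∧ ∑ i, 1 / p i < 1

/-- `q`, with `0 < q < ∞`, is a proper cotype for `n`-linear operators. -/
def IsProperCotype (n : ℕ) (q : ℝ) : Prop :=
  0 < q ∧ 2 / (n : ℝ) ≤ q

/-- `HasIteratedLim l f [i₁, …, iₘ] h` says that the iterated limit
`lim_{x_{i₁} → l i₁} ⋯ lim_{x_{iₘ} → l iₘ} f(x)` exists (the head of the list is the outermost
limit) and that its value, as a function of the remaining variables, is `h`. -/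
def HasIteratedLim {n : ℕ} {E : Fin n → Type*} {X : Type*} [TopologicalSpace X]
    (l : ∀ i, Filter (E i)) (f : (∀ i, E i) → X) :
    List (Fin n) → ((∀ i, E i) → X) → Prop
  | [], h => h = f
  | i :: is, h => ∃ g, HasIteratedLim l f is g ∧
      ∀ x : ∀ i, E i, Tendsto (fun t : E i => g (Function.update x i t)) (l i) (𝓝 (h x))

section AronBerner

variable {𝕜 : Type*} [RCLike 𝕜] {n : ℕ}
  {E : Fin n → Type*} [∀ i, NormedAddCommGroup (E i)] [∀ i, NormedSpace 𝕜 (E i)]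
  {F : Type*} [NormedAddCommGroup F] [NormedSpace 𝕜 F]

/-- The bidual `G''` of a normed space, with its norm. -/
abbrev Bidual (𝕜 : Type*) [RCLike 𝕜] (G : Type*) [NormedAddCommGroup G] [NormedSpace 𝕜 G] :
    Type _ :=
  StrongDual 𝕜 (StrongDual 𝕜 G)

/-- The canonical embedding `J_G : G → G''`, with `G''` carrying its weak-star topology. -/
def bidualEmb (𝕜 : Type*) [RCLike 𝕜] (G : Type*) [NormedAddCommGroup G] [NormedSpace 𝕜 G]
    (x : G) : WeakDual 𝕜 (StrongDual 𝕜 G) :=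
  StrongDual.toWeakDual (NormedSpace.inclusionInDoubleDual 𝕜 G x)

/-- `B : E₁'' × ⋯ × Eₙ'' → F''` is the Aron-Berner extension of `A` for the order `σ`: for all
`yᵢ ∈ Eᵢ''` and all nets in `Eᵢ` that converge weak-star to `yᵢ`, the iterated weak-star limit
of `J_F ∘ A` along these nets, taken in the order `σ 0` (outermost), …, `σ (n-1)` (innermost), is
`B(y₁, …, yₙ)`. A net enters through its filter of tails; these are the proper filters on `Eᵢ`. -/
def IsAronBernerExtensionInOrder (σ : Equiv.Perm (Fin n)) (A : ContinuousMultilinearMap 𝕜 E F)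
    (B : ContinuousMultilinearMap 𝕜 (fun i => Bidual 𝕜 (E i)) (Bidual 𝕜 F)) : Prop :=
  ∀ (y : ∀ i, Bidual 𝕜 (E i)) (l : ∀ i, Filter (E i)),
    (∀ i, (l i).NeBot) →
    (∀ i, Tendsto (bidualEmb 𝕜 (E i)) (l i) (𝓝 (StrongDual.toWeakDual (y i)))) →
    HasIteratedLim l (fun x => bidualEmb 𝕜 F (A x)) (List.ofFn σ)
      (fun _ => StrongDual.toWeakDual (B y))

/-- `B` is one of the (at most `n!`) Aron-Berner extensions of `A`. -/
def IsAronBernerExtension (A : ContinuousMultilinearMap 𝕜 E F)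
    (B : ContinuousMultilinearMap 𝕜 (fun i => Bidual 𝕜 (E i)) (Bidual 𝕜 F)) : Prop :=
  ∃ σ : Equiv.Perm (Fin n), IsAronBernerExtensionInOrder σ A B

end AronBerner

end

/-! The values of an Aron–Berner extension `B` of `A` are iterated weak-star limits of values of
`A`. Both `‖·‖_q` and `‖·‖_Rad` are weak-star lower semicontinuous on tuples in a bidual, so the
estimate for `B` follows from that for `A` as soon as each tuple in `Eᵢ''` is a coordinatewise
weak-star limit of tuples in `Eᵢ` whose norm is larger by at most a prescribed `δ > 0`. For `‖·‖_p`
this is Goldstine's theorem in each coordinate. For `‖·‖_Rad` it is Goldstine's theorem relative to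
the operator `x ↦ (√w(s) ∑ⱼ sⱼ xⱼ)ₛ`, where `w(s)` is the probability of the sign pattern `s`: this
operator turns the Rademacher norm into an `ℓ₂`-norm. Conversely, `B` restricts to `A`, and the
embeddings `Eᵢ → Eᵢ''` are isometric. -/

noncomputable section

section Rademacher

open MeasureTheory

theorem integral_comp_eq_sum {Ω S : Type*} [MeasurableSpace Ω] [Fintype S] [MeasurableSpace S]
    [MeasurableSingletonClass S] (μ : Measure Ω) [IsFiniteMeasure μ] {φ : Ω → S}
    (hφ : Measurable φ) (g : S → ℝ) :
    ∫ ω, g (φ ω) ∂μ = ∑ s, μ.real (φ ⁻¹' {s}) * g s := by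
  rw [← integral_map hφ.aemeasurable (measurable_of_finite g).aestronglyMeasurable,
    integral_fintype .of_finite]
  simp only [map_measureReal_apply hφ (measurableSet_singleton _), smul_eq_mul]

/-- The signs of the first `k` Rademacher functions at the point `t`. -/
def radSign (k : ℕ) (t : ℝ) (j : Fin k) : SignType :=
  SignType.sign (Real.sin (2 ^ ((j : ℕ) + 1) * Real.pi * t))

theorem rademacher_eq_radSign {k : ℕ} (j : Fin k) (t : ℝ) :
    rademacher j t = (radSign k t j : ℝ) := by
  unfold rademacher radSign Real.sign
  rcases lt_trichotomy (Real.sin (2 ^ ((j : ℕ) + 1) * Real.pi * t)) 0 with h | h | h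
  · simp [h]
  · simp [h]
  · simp [h, h.not_gt]

local instance : MeasurableSpace SignType := ⊤

local instance : MeasurableSingletonClass SignType := ⟨fun _ => trivial⟩

theorem measurable_sign : Measurable (SignType.sign : ℝ → SignType) :=
  Measurable.ite measurableSet_Ioi measurable_const
    (Measurable.ite measurableSet_Iio measurable_const measurable_const)

theorem measurable_radSign (k : ℕ) : Measurable (radSign k) :=
  measurable_pi_lambda _ fun _ => measurable_sign.comp (by fun_prop)

/-- The probability that the first `k` Rademacher functions take the values `s`. -/
def radWeight (k : ℕ) (s : Fin k → SignType) : ℝ :=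
  (volume.restrict (Set.Ioc (0 : ℝ) 1)).real (radSign k ⁻¹' {s})

variable (𝕜 : Type*) [RCLike 𝕜] {E : Type*} [NormedAddCommGroup E] [NormedSpace 𝕜 E]

/-- The coefficient `√w(s) sⱼ`. With the weight absorbed in this way, the Rademacher norm is the
`ℓ₂`-norm of the vectors `∑ⱼ √w(s) sⱼ xⱼ`, where `s` runs through the sign patterns. -/
def radCoeff (k : ℕ) (s : Fin k → SignType) (j : Fin k) : 𝕜 :=
  ((√(radWeight k s) * (s j : ℝ) : ℝ) : 𝕜)

theorem norm_sum_radCoeff_smul_sq {k : ℕ} (s : Fin k → SignType) (x : Fin k → E) :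
    ‖∑ j, radCoeff 𝕜 k s j • x j‖ ^ 2 =
      radWeight k s * ‖∑ j, ((s j : ℝ) : 𝕜) • x j‖ ^ 2 := by
  have hw : 0 ≤ radWeight k s := measureReal_nonneg
  simp only [radCoeff, RCLike.ofReal_mul, mul_smul, ← Finset.smul_sum, norm_smul,
    RCLike.norm_ofReal, mul_pow, sq_abs, Real.sq_sqrt hw]

theorem radNorm_eq_sqrt_sum {k : ℕ} (x : Fin k → E) :
    radNorm 𝕜 x = √(∑ s, ‖∑ j, radCoeff 𝕜 k s j • x j‖ ^ 2) := by
  simp only [radNorm, rademacher_eq_radSign, norm_sum_radCoeff_smul_sq,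
    intervalIntegral.integral_of_le zero_le_one]
  rw [integral_comp_eq_sum _ (measurable_radSign k) fun s => ‖∑ j, ((s j : ℝ) : 𝕜) • x j‖ ^ 2]
  rfl

theorem radNorm_nonneg {k : ℕ} (x : Fin k → E) : 0 ≤ radNorm 𝕜 x := Real.sqrt_nonneg _

theorem lpSeqNorm_nonneg (p : ℝ) {k : ℕ} (x : Fin k → E) : 0 ≤ lpSeqNorm p x :=
  Real.rpow_nonneg (Finset.sum_nonneg fun _ _ => Real.rpow_nonneg (norm_nonneg _) _) _

theorem norm_inclusionInDoubleDual (x : E) : ‖NormedSpace.inclusionInDoubleDual 𝕜 E x‖ = ‖x‖ :=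
  (NormedSpace.inclusionInDoubleDualLi 𝕜).norm_map x

theorem radNorm_inclusionInDoubleDual {k : ℕ} (x : Fin k → E) :
    radNorm 𝕜 (fun j => NormedSpace.inclusionInDoubleDual 𝕜 E (x j)) = radNorm 𝕜 x := by
  simp only [radNorm, ← map_smul, ← map_sum, norm_inclusionInDoubleDual]

theorem lpSeqNorm_inclusionInDoubleDual (p : ℝ) {k : ℕ} (x : Fin k → E) :
    lpSeqNorm p (fun j => NormedSpace.inclusionInDoubleDual 𝕜 E (x j)) = lpSeqNorm p x := by
  simp only [lpSeqNorm, norm_inclusionInDoubleDual]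

end Rademacher

section LowerSemicontinuity

variable (𝕜 : Type*) [RCLike 𝕜] {G : Type*} [NormedAddCommGroup G] [NormedSpace 𝕜 G]

theorem lowerSemicontinuous_norm_toStrongDual :
    LowerSemicontinuous fun z : WeakDual 𝕜 G => ‖WeakDual.toStrongDual z‖ := by
  rw [lowerSemicontinuous_iff_isClosed_preimage]
  intro r
  simpa [Set.preimage, Metric.closedBall, dist_zero_right] using
    WeakDual.isClosed_closedBall (𝕜 := 𝕜) (0 : StrongDual 𝕜 G) r

theorem lowerSemicontinuous_rpow_const {X : Type*} [TopologicalSpace X] {f : X → ℝ}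
    (hf : LowerSemicontinuous f) (hf0 : ∀ x, 0 ≤ f x) {p : ℝ} (hp : 0 ≤ p) :
    LowerSemicontinuous fun x => f x ^ p := by
  have h := Continuous.comp_lowerSemicontinuous (g := fun t : ℝ => (max t 0) ^ p)
    ((continuous_id.max continuous_const).rpow_const fun _ => Or.inr hp) hf
    fun a b hab => Real.rpow_le_rpow (le_max_right _ _) (max_le_max_right 0 hab) hp
  simpa only [Function.comp_def, max_eq_left (hf0 _)] using h

theorem lowerSemicontinuous_lpSum {X ι : Type*} [TopologicalSpace X] [Fintype ι]
    {f : ι → X → WeakDual 𝕜 G} (hf : ∀ i, Continuous (f i)) {p : ℝ} (hp : 0 < p) :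
    LowerSemicontinuous fun x => (∑ i, ‖WeakDual.toStrongDual (f i x)‖ ^ p) ^ (1 / p) := by
  refine lowerSemicontinuous_rpow_const (lowerSemicontinuous_sum fun i _ =>
    lowerSemicontinuous_rpow_const ?_ (fun _ => norm_nonneg _) hp.le) (fun _ => ?_) ?_
  · exact (lowerSemicontinuous_norm_toStrongDual 𝕜).comp (hf i)
  all_goals positivity

theorem lowerSemicontinuous_lpSeqNorm {p : ℝ} (hp : 0 < p) (k : ℕ) :
    LowerSemicontinuous fun w : Fin k → WeakDual 𝕜 G =>
      lpSeqNorm p fun j => WeakDual.toStrongDual (w j) :=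
  lowerSemicontinuous_lpSum 𝕜 continuous_apply hp

theorem lowerSemicontinuous_radNorm (k : ℕ) :
    LowerSemicontinuous fun w : Fin k → WeakDual 𝕜 G =>
      radNorm 𝕜 fun j => WeakDual.toStrongDual (w j) := by
  have hcont (s : Fin k → SignType) :
      Continuous fun w : Fin k → WeakDual 𝕜 G => ∑ j, radCoeff 𝕜 k s j • w j := by fun_prop
  simpa only [radNorm_eq_sqrt_sum, Real.sqrt_eq_rpow, Real.rpow_two, map_sum, map_smul] using
    lowerSemicontinuous_lpSum 𝕜 hcont two_pos

end LowerSemicontinuity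

section Goldstine

variable {𝕜 : Type*} [RCLike 𝕜]

theorem norm_le_mul_norm_of_forall_norm_le {V W : Type*} [AddCommGroup V] [Module 𝕜 V]
    [NormedAddCommGroup W] [NormedSpace 𝕜 W] {P : V →ₗ[𝕜] W} {φ : V →ₗ[𝕜] 𝕜} {r u : ℝ}
    (hr : 0 < r) (hφ : ∀ x, ‖P x‖ ≤ r → ‖φ x‖ ≤ u) (x : V) : ‖φ x‖ ≤ u / r * ‖P x‖ := by
  have : 0 ≤ u := (norm_nonneg _).trans (hφ 0 (by simpa using hr.le))
  have hscale (ε : ℝ) (hε : 0 < ε) : ‖φ x‖ ≤ u / r * (‖P x‖ + ε) := by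
    have hpos : 0 < ‖P x‖ + ε := by positivity
    have h := hφ (((r / (‖P x‖ + ε) : ℝ) : 𝕜) • x) (by
      rw [map_smul, norm_smul, RCLike.norm_ofReal, abs_of_pos (by positivity), div_mul_comm]
      exact mul_le_of_le_one_left hr.le ((div_le_one hpos).2 (by linarith)))
    rw [map_smul, norm_smul, RCLike.norm_ofReal, abs_of_pos (by positivity)] at h
    calc ‖φ x‖ = (r / (‖P x‖ + ε) * ‖φ x‖) * ((‖P x‖ + ε) / r) := by field_simp
      _ ≤ u * ((‖P x‖ + ε) / r) := by gcongr
      _ = u / r * (‖P x‖ + ε) := by ring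
  have hlim : Tendsto (fun ε : ℝ => u / r * (‖P x‖ + ε)) (𝓝[>] 0) (𝓝 (u / r * (‖P x‖ + 0))) :=
    (Continuous.tendsto (by fun_prop) _).mono_left nhdsWithin_le_nhds
  simpa only [add_zero] using ge_of_tendsto hlim (eventually_mem_nhdsWithin.mono hscale)

theorem exists_factor_of_norm_le {V W : Type*} [AddCommGroup V] [Module 𝕜 V]
    [NormedAddCommGroup W] [NormedSpace 𝕜 W] (P : V →ₗ[𝕜] W) (φ : V →ₗ[𝕜] 𝕜) {C : ℝ}
    (hC : 0 ≤ C) (h : ∀ x, ‖φ x‖ ≤ C * ‖P x‖) :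
    ∃ g : StrongDual 𝕜 W, ‖g‖ ≤ C ∧ ∀ x, g (P x) = φ x := by
  obtain ⟨Q, hQ⟩ := P.rangeRestrict.exists_rightInverse_of_surjective P.range_rangeRestrict
  have hPQ (v : LinearMap.range P) : P (Q v) = v :=
    congrArg Subtype.val (LinearMap.congr_fun hQ v)
  let g₀ : StrongDual 𝕜 (LinearMap.range P) := (φ ∘ₗ Q).mkContinuous C fun v => by
    simpa [hPQ] using h (Q v)
  obtain ⟨g, hg, hgn⟩ := exists_extension_norm_eq (LinearMap.range P) g₀
  refine ⟨g, hgn.trans_le (LinearMap.mkContinuous_norm_le _ hC _), fun x => ?_⟩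
  have hgx : g (P x) = φ (Q ⟨P x, x, rfl⟩) := hg ⟨P x, x, rfl⟩
  have hker := h (Q ⟨P x, x, rfl⟩ - x)
  rw [map_sub, map_sub, hPQ, sub_self, norm_zero, mul_zero, norm_le_zero_iff, sub_eq_zero] at hker
  exact hgx.trans hker

variable {V : Type*} [NormedAddCommGroup V] [NormedSpace 𝕜 V]

set_option maxSynthPendingDepth 3 in
theorem exists_forall_re_lt_of_notMem_closure {K : Set (WeakDual 𝕜 V)} (hK : Convex ℝ K)
    {z : WeakDual 𝕜 V} (hz : z ∉ closure K) :
    ∃ (φ : V) (u : ℝ), (∀ w ∈ K, RCLike.re (w φ) < u) ∧ u < RCLike.re (z φ) := by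
  have : LocallyConvexSpace ℝ (WeakDual 𝕜 V) := (WeakDual.withSeminorms 𝕜 V).toLocallyConvexSpace
  obtain ⟨f, u, hfu, hu⟩ := RCLike.geometric_hahn_banach_closed_point (𝕜 := 𝕜)
    hK.closure isClosed_closure hz
  obtain ⟨φ, hφ⟩ := LinearMap.dualEmbedding_surjective (topDualPairing 𝕜 V) f
  have hf (w : WeakDual 𝕜 V) : f w = w φ := (DFunLike.congr_fun hφ w).symm
  exact ⟨φ, u, fun w hw => hf w ▸ hfu w (subset_closure hw), hf z ▸ hu⟩

theorem convex_bidualEmb_image {W : Type*} [NormedAddCommGroup W] [NormedSpace 𝕜 W]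
    (P : V →L[𝕜] W) (r : ℝ) : Convex ℝ (bidualEmb 𝕜 V '' {x | ‖P x‖ ≤ r}) := by
  rintro _ ⟨x, hx, rfl⟩ _ ⟨x', hx', rfl⟩ a b ha hb hab
  refine ⟨(a : 𝕜) • x + (b : 𝕜) • x', ?_, ?_⟩
  · calc ‖P ((a : 𝕜) • x + (b : 𝕜) • x')‖ ≤ a * ‖P x‖ + b * ‖P x'‖ := by
          simpa only [map_add, map_smul, norm_smul, RCLike.norm_ofReal, abs_of_nonneg ha,
            abs_of_nonneg hb] using norm_add_le ((a : 𝕜) • P x) ((b : 𝕜) • P x')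
      _ ≤ a * r + b * r := by gcongr <;> assumption
      _ = r := by rw [← add_mul, hab, one_mul]
  · refine ContinuousLinearMap.ext fun φ => ?_
    change φ ((a : 𝕜) • x + (b : 𝕜) • x') = a • φ x + b • φ x'
    simp [RCLike.real_smul_eq_coe_mul]

/-- Goldstine's theorem is the case `P = id`. -/
theorem mem_closure_bidualEmb_image {W : Type*} [NormedAddCommGroup W] [NormedSpace 𝕜 W]
    (P : V →L[𝕜] W) {y : Bidual 𝕜 V} {r : ℝ} (hr : 0 < r)
    (hy : ∀ g : StrongDual 𝕜 W, ‖y (g.comp P)‖ ≤ r * ‖g‖) :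
    StrongDual.toWeakDual y ∈ closure (bidualEmb 𝕜 V '' {x | ‖P x‖ ≤ r}) := by
  by_contra hmem
  obtain ⟨φ, u, hφ, hu⟩ :=
    exists_forall_re_lt_of_notMem_closure (convex_bidualEmb_image P r) hmem
  have hre (x : V) (hx : ‖P x‖ ≤ r) : RCLike.re (φ x) < u := hφ _ ⟨x, hx, rfl⟩
  have hnorm (x : V) (hx : ‖P x‖ ≤ r) : ‖φ x‖ ≤ u := by
    obtain ⟨c, hc, hcx⟩ := RCLike.exists_norm_eq_mul_self (φ x)
    have h := hre (c • x) (by rwa [map_smul, norm_smul, hc, one_mul])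
    rw [map_smul, smul_eq_mul, ← hcx, RCLike.ofReal_re] at h
    exact h.le
  have hu0 : 0 ≤ u := (norm_nonneg _).trans (hnorm 0 (by simpa using hr.le))
  obtain ⟨g, hg, hgP⟩ := exists_factor_of_norm_le P.toLinearMap φ.toLinearMap (C := u / r)
    (by positivity) (norm_le_mul_norm_of_forall_norm_le hr hnorm)
  have hφg : g.comp P = φ := ContinuousLinearMap.ext hgP
  refine hu.not_ge ?_
  calc RCLike.re (y φ) ≤ ‖y (g.comp P)‖ := hφg ▸ RCLike.re_le_norm (y φ)
    _ ≤ r * (u / r) := (hy g).trans (by gcongr)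
    _ = u := mul_div_cancel₀ u hr.ne'

theorem exists_filter_of_mem_closure_image {X Y : Type*} [TopologicalSpace Y] {f : X → Y}
    {S : Set X} {y : Y} (hy : y ∈ closure (f '' S)) :
    ∃ L : Filter X, L.NeBot ∧ Tendsto f L (𝓝 y) ∧ S ∈ L := by
  rw [mem_closure_iff_clusterPt, ClusterPt, ← map_principal, ← Filter.push_pull'] at hy
  exact ⟨comap f (𝓝 y) ⊓ 𝓟 S, map_neBot_iff f |>.1 hy, tendsto_comap.mono_left inf_le_left,
    mem_inf_of_right (mem_principal_self S)⟩

theorem exists_filter_tendsto_norm_le (y : Bidual 𝕜 V) :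
    ∃ L : Filter V, L.NeBot ∧
      Tendsto (bidualEmb 𝕜 V) L (𝓝 (StrongDual.toWeakDual y)) ∧ ∀ᶠ x in L, ‖x‖ ≤ ‖y‖ := by
  rcases eq_or_ne y 0 with rfl | hy
  · refine ⟨pure 0, inferInstance, ?_, norm_zero.trans_le (norm_nonneg (0 : Bidual 𝕜 V))⟩
    simpa [bidualEmb] using tendsto_pure_nhds (bidualEmb 𝕜 V) 0
  · exact exists_filter_of_mem_closure_image <| mem_closure_bidualEmb_image
      (ContinuousLinearMap.id 𝕜 V) (norm_pos_iff (a := y).2 hy) y.le_opNorm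

end Goldstine

section Tuples

variable {𝕜 : Type*} [RCLike 𝕜] {E : Type*} [NormedAddCommGroup E] [NormedSpace 𝕜 E]
  {ι σ : Type*} [Fintype ι]

/-- The action on tuples of a scalar matrix, `x ↦ (∑ⱼ aₛⱼ xⱼ)ₛ`. -/
def matrixAction (𝕜 E : Type*) [RCLike 𝕜] [NormedAddCommGroup E] [NormedSpace 𝕜 E]
    (a : σ → ι → 𝕜) : (ι → E) →L[𝕜] σ → E :=
  ContinuousLinearMap.pi fun s => ∑ j, a s j • ContinuousLinearMap.proj j

theorem matrixAction_apply (a : σ → ι → 𝕜) (x : ι → E) (s : σ) :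
    matrixAction 𝕜 E a x s = ∑ j, a s j • x j := by
  simp [matrixAction]

variable [DecidableEq ι]

/-- The element of `(E^ι)''` which corresponds to a tuple in `E''` under the identification
`(E^ι)'' = (E'')^ι`. -/
def bidualTuple (y : ι → Bidual 𝕜 E) : Bidual 𝕜 (ι → E) :=
  ∑ j, (y j).comp ((ContinuousLinearMap.compL 𝕜 E (ι → E) 𝕜).flip
    (ContinuousLinearMap.single 𝕜 (fun _ : ι => E) j))

theorem bidualTuple_apply (y : ι → Bidual 𝕜 E) (Φ : StrongDual 𝕜 (ι → E)) :
    bidualTuple y Φ = ∑ j, y j (Φ.comp (ContinuousLinearMap.single 𝕜 (fun _ : ι => E) j)) := by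
  simp [bidualTuple]

theorem bidualTuple_comp_proj (y : ι → Bidual 𝕜 E) (j : ι) (φ : StrongDual 𝕜 E) :
    bidualTuple y (φ.comp (ContinuousLinearMap.proj j)) = y j φ := by
  rw [bidualTuple_apply, Finset.sum_eq_single j]
  · congr 1
    ext x
    simp
  · intro i _ hi
    convert map_zero (y i)
    ext x
    simp [hi.symm]
  · simp

theorem tendsto_bidualEmb_apply {L : Filter (ι → E)} {y : ι → Bidual 𝕜 E}
    (hL : Tendsto (bidualEmb 𝕜 (ι → E)) L (𝓝 (StrongDual.toWeakDual (bidualTuple y)))) (j : ι) :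
    Tendsto (fun x => bidualEmb 𝕜 E (x j)) L (𝓝 (StrongDual.toWeakDual (y j))) := by
  rw [tendsto_iff_forall_eval_tendsto_topDualPairing] at hL ⊢
  intro φ
  have h := hL (φ.comp (ContinuousLinearMap.proj j))
  exact h.trans_eq (congrArg 𝓝 (bidualTuple_comp_proj y j φ))

variable [Fintype σ] [DecidableEq σ]

theorem bidualTuple_comp_matrixAction (a : σ → ι → 𝕜) (y : ι → Bidual 𝕜 E)
    (Φ : StrongDual 𝕜 (σ → E)) :
    bidualTuple y (Φ.comp (matrixAction 𝕜 E a)) = bidualTuple (fun s => ∑ j, a s j • y j) Φ := by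
  have hcol (j : ι) :
      (Φ.comp (matrixAction 𝕜 E a)).comp (ContinuousLinearMap.single 𝕜 (fun _ : ι => E) j) =
        ∑ s, a s j • Φ.comp (ContinuousLinearMap.single 𝕜 (fun _ : σ => E) s) := by
    ext x
    have hx : matrixAction 𝕜 E a (Pi.single j x) = fun s => a s j • x := by
      ext s
      simp [matrixAction_apply, Pi.single_apply]
    simp [hx, ← ContinuousLinearMap.sum_comp_single 𝕜 _ Φ fun s => a s j • x]
  simp only [bidualTuple_apply, hcol, map_sum, map_smul, sum_apply, smul_apply]
  exact Finset.sum_comm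

/-- Approximating `z` coordinatewise by Goldstine's theorem transfers the bound to the bidual. -/
theorem norm_bidualTuple_apply_le {Φ : StrongDual 𝕜 (σ → E)} {C : ℝ} (hC : 0 ≤ C)
    (hΦ : ∀ x, ‖Φ x‖ ≤ C * √(∑ s, ‖x s‖ ^ 2)) (z : σ → Bidual 𝕜 E) :
    ‖bidualTuple z Φ‖ ≤ C * √(∑ s, ‖z s‖ ^ 2) := by
  choose L hL hlim hle using fun s => exists_filter_tendsto_norm_le (z s)
  have hlimΦ : Tendsto (fun x => ‖Φ x‖) (Filter.pi L) (𝓝 ‖bidualTuple z Φ‖) := by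
    simp only [bidualTuple_apply, ← ContinuousLinearMap.sum_comp_single 𝕜 _ Φ]
    refine (tendsto_finsetSum _ fun s _ => ?_).norm
    exact (tendsto_iff_forall_eval_tendsto_topDualPairing.1 (hlim s) _).comp (tendsto_eval_pi L s)
  have hbound : ∀ᶠ x in Filter.pi L, ∀ s, ‖x s‖ ≤ ‖z s‖ :=
    eventually_all.2 fun s => (tendsto_eval_pi L s).eventually (hle s)
  refine le_of_tendsto hlimΦ (hbound.mono fun x hx => (hΦ x).trans ?_)
  gcongr with s
  exact hx s

end Tuples

section Approximation

variable {𝕜 : Type*} [RCLike 𝕜] {E : Type*} [NormedAddCommGroup E] [NormedSpace 𝕜 E]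

/-- The tuple `y` in the bidual is a coordinatewise weak-star limit of tuples `x` in the space
which satisfy `ν x ≤ r`. -/
def IsWeakStarApproximable {ι : Type*} (ν : (ι → E) → ℝ) (y : ι → Bidual 𝕜 E) (r : ℝ) : Prop :=
  ∃ L : Filter (ι → E), L.NeBot ∧
    (∀ j, Tendsto (fun x => bidualEmb 𝕜 E (x j)) L (𝓝 (StrongDual.toWeakDual (y j)))) ∧
    ∀ᶠ x in L, ν x ≤ r

theorem isWeakStarApproximable_lpSeqNorm {p : ℝ} (hp : 0 < p) {k : ℕ} (y : Fin k → Bidual 𝕜 E)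
    {r : ℝ} (hr : lpSeqNorm p y ≤ r) : IsWeakStarApproximable (lpSeqNorm p) y r := by
  choose L hL hlim hle using fun j => exists_filter_tendsto_norm_le (y j)
  have hbound : ∀ᶠ x in Filter.pi L, ∀ j, ‖x j‖ ≤ ‖y j‖ :=
    eventually_all.2 fun j => (tendsto_eval_pi L j).eventually (hle j)
  refine ⟨Filter.pi L, inferInstance, fun j => (hlim j).comp (tendsto_eval_pi L j),
    hbound.mono fun x hx => le_trans ?_ hr⟩
  unfold lpSeqNorm
  gcongr with j
  exact hx j

theorem isWeakStarApproximable_radNorm {k : ℕ} (y : Fin k → Bidual 𝕜 E) {r : ℝ}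
    (hr : radNorm 𝕜 y < r) : IsWeakStarApproximable (radNorm 𝕜) y r := by
  classical
  let toL2 : ((Fin k → SignType) → E) →L[𝕜] PiLp 2 fun _ : Fin k → SignType => E :=
    (PiLp.continuousLinearEquiv 2 𝕜 _).symm.toContinuousLinearMap
  let P := toL2.comp (matrixAction 𝕜 E (radCoeff 𝕜 k))
  have hP (x : Fin k → E) : ‖P x‖ = radNorm 𝕜 x := by
    simp only [radNorm_eq_sqrt_sum, ← matrixAction_apply]
    exact PiLp.norm_eq_of_L2 _
  have hdual (g : StrongDual 𝕜 (PiLp 2 fun _ : Fin k → SignType => E)) :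
      ‖bidualTuple y (g.comp P)‖ ≤ r * ‖g‖ := by
    calc ‖bidualTuple y (g.comp P)‖
        = ‖bidualTuple (fun s => ∑ j, radCoeff 𝕜 k s j • y j) (g.comp toL2)‖ :=
          congrArg norm (bidualTuple_comp_matrixAction (radCoeff 𝕜 k) y (g.comp toL2))
      _ ≤ ‖g‖ * √(∑ s, ‖∑ j, radCoeff 𝕜 k s j • y j‖ ^ 2) :=
          norm_bidualTuple_apply_le (norm_nonneg g)
            (fun x => (g.le_opNorm _).trans_eq (by rw [PiLp.norm_eq_of_L2]; rfl)) _
      _ = radNorm 𝕜 y * ‖g‖ := by rw [mul_comm, radNorm_eq_sqrt_sum]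
      _ ≤ r * ‖g‖ := by gcongr
  obtain ⟨L, hL, hlim, hle⟩ := exists_filter_of_mem_closure_image
    (mem_closure_bidualEmb_image P ((radNorm_nonneg 𝕜 y).trans_lt hr) hdual)
  simp only [hP] at hle
  exact ⟨L, hL, tendsto_bidualEmb_apply hlim, hle⟩

end Approximation

section IteratedLimits

variable {n : ℕ} {E : Fin n → Type*} {X : Type*} [TopologicalSpace X]

theorem HasIteratedLim.mem_of_isClosed {ι : Type*} {K : Set (ι → X)} (hK : IsClosed K)
    {S : ∀ i, Set (ι → E i)} {L : ∀ i, Filter (ι → E i)} (hL : ∀ i, (L i).NeBot)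
    (hS : ∀ i, S i ∈ L i) {f : (∀ i, E i) → X}
    (hf : ∀ x : ∀ i, ι → E i, (∀ i, x i ∈ S i) → (fun j => f fun i => x i j) ∈ K)
    {is : List (Fin n)} {h : ι → (∀ i, E i) → X}
    (hh : ∀ j, HasIteratedLim (fun i => map (fun x : ι → E i => x j) (L i)) f is (h j))
    {x : ∀ i, ι → E i} (hx : ∀ i, x i ∈ S i) :
    (fun j => h j fun i => x i j) ∈ K := by
  induction is generalizing h x with
  | nil =>
    obtain rfl : h = fun _ => f := funext hh
    exact hf x hx
  | cons i is ih =>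
    choose g hg hlim using hh
    have := hL i
    have htendsto : Tendsto (fun t j => g j fun m => Function.update x i t m j) (L i)
        (𝓝 fun j => h j fun m => x m j) := by
      refine tendsto_pi_nhds.2 fun j => ?_
      refine (tendsto_map'_iff.1 (hlim j fun m => x m j)).congr fun t => ?_
      exact congrArg (g j) (funext fun m => (Function.apply_update (fun _ z => z j) x i t m).symm)
    have hmem : ∀ᶠ t in L i, (fun j => g j fun m => Function.update x i t m j) ∈ K := by
      filter_upwards [hS i] with t ht
      exact ih hg ((Function.forall_update_iff x fun m z => z ∈ S m).2 ⟨ht, fun m _ => hx m⟩)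
    exact hK.mem_of_tendsto htendsto hmem

theorem HasIteratedLim.eq_of_pure [T2Space X] {f : (∀ i, E i) → X} {a : ∀ i, E i}
    {is : List (Fin n)} {h : (∀ i, E i) → X}
    (hh : HasIteratedLim (fun i => pure (a i)) f is h) (x : ∀ i, E i) :
    h x = f (fun i => if i ∈ is then a i else x i) := by
  induction is generalizing h x with
  | nil =>
    obtain rfl : h = f := hh
    simp
  | cons i is ih =>
    obtain ⟨g, hg, hlim⟩ := hh
    rw [tendsto_nhds_unique (hlim x) (tendsto_pure_nhds _ (a i)), ih hg]
    congr 1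
    ext m
    rcases eq_or_ne m i with rfl | hne
    · simp
    · simp [hne]

end IteratedLimits

section Uncurry

variable {𝕜 : Type*} [NontriviallyNormedField 𝕜] {n : ℕ} {E D : Fin (n + 1) → Type*}
  [∀ i, NormedAddCommGroup (E i)] [∀ i, NormedSpace 𝕜 (E i)]
  [∀ i, NormedAddCommGroup (D i)] [∀ i, NormedSpace 𝕜 (D i)]
  {F H : Type*} [NormedAddCommGroup F] [NormedSpace 𝕜 F] [NormedAddCommGroup H] [NormedSpace 𝕜 H]

/-- Combines an extension operator `S` for the first variable with an extension operator `Λ` for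
the remaining variables. -/
def consExtension (S : (E 0 →L[𝕜] H) →L[𝕜] D 0 →L[𝕜] H)
    (Λ : ContinuousMultilinearMap 𝕜 (fun i : Fin n => E i.succ) F →L[𝕜]
      ContinuousMultilinearMap 𝕜 (fun i : Fin n => D i.succ) H) :
    ContinuousMultilinearMap 𝕜 E F →L[𝕜] ContinuousMultilinearMap 𝕜 D H :=
  let curryE := (continuousMultilinearCurryLeftEquiv 𝕜 E F).toContinuousLinearEquiv
  let uncurryD := (continuousMultilinearCurryLeftEquiv 𝕜 D H).symm.toContinuousLinearEquiv
  let flipE := ContinuousLinearMap.flipMultilinearEquiv 𝕜 (fun i : Fin n => D i.succ) (E 0) H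
  let flipD := ContinuousLinearMap.flipMultilinearEquiv 𝕜 (fun i : Fin n => D i.succ) (D 0) H
  let extendTail := ContinuousLinearMap.compL 𝕜 (E 0) _ _ Λ
  let extendHead := ContinuousLinearMap.compContinuousMultilinearMapL 𝕜
    (fun i : Fin n => D i.succ) _ _ S
  uncurryD.toContinuousLinearMap ∘L flipD.symm.toContinuousLinearMap ∘L extendHead ∘L
    flipE.toContinuousLinearMap ∘L extendTail ∘L curryE.toContinuousLinearMap

theorem consExtension_apply (S : (E 0 →L[𝕜] H) →L[𝕜] D 0 →L[𝕜] H)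
    (Λ : ContinuousMultilinearMap 𝕜 (fun i : Fin n => E i.succ) F →L[𝕜]
      ContinuousMultilinearMap 𝕜 (fun i : Fin n => D i.succ) H)
    (A : ContinuousMultilinearMap 𝕜 E F) (y : ∀ i, D i) :
    consExtension S Λ A y = S ((Λ.comp A.curryLeft).flipMultilinear (Fin.tail y)) (y 0) :=
  rfl

end Uncurry

section Existence

set_option maxSynthPendingDepth 3

/-- The extension `X'' → G'` of an operator `T : X → G'` which is continuous for the weak-star
topologies. -/
def extendToBidual (𝕜 X G : Type*) [RCLike 𝕜] [NormedAddCommGroup X] [NormedSpace 𝕜 X]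
    [NormedAddCommGroup G] [NormedSpace 𝕜 G] :
    (X →L[𝕜] StrongDual 𝕜 G) →L[𝕜] Bidual 𝕜 X →L[𝕜] StrongDual 𝕜 G :=
  (ContinuousLinearMap.compL 𝕜 G (StrongDual 𝕜 X) 𝕜).flip.comp
    (ContinuousLinearMap.flipₗᵢ 𝕜 X G 𝕜).toContinuousLinearEquiv.toContinuousLinearMap

variable {𝕜 : Type*} [RCLike 𝕜]

theorem extendToBidual_apply {X G : Type*} [NormedAddCommGroup X] [NormedSpace 𝕜 X]
    [NormedAddCommGroup G] [NormedSpace 𝕜 G] (T : X →L[𝕜] StrongDual 𝕜 G) (z : Bidual 𝕜 X)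
    (φ : G) : extendToBidual 𝕜 X G T z φ = z (T.flip φ) :=
  rfl

/-- `B` extends `A` to the biduals and `B` is weak-star continuous in the `i`-th variable whenever
the variables before the `i`-th one belong to the original spaces. -/
def IsSuccessivelyWeakStarExtension {n : ℕ}
    {E : Fin n → Type*} [∀ i, NormedAddCommGroup (E i)] [∀ i, NormedSpace 𝕜 (E i)]
    {F : Type*} [NormedAddCommGroup F] [NormedSpace 𝕜 F] (A : ContinuousMultilinearMap 𝕜 E F)
    (B : ContinuousMultilinearMap 𝕜 (fun i => Bidual 𝕜 (E i)) (Bidual 𝕜 F)) : Prop :=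
  (∀ x : ∀ i, E i, B (fun i => NormedSpace.inclusionInDoubleDual 𝕜 (E i) (x i)) =
      NormedSpace.inclusionInDoubleDual 𝕜 F (A x)) ∧
    ∀ (i : Fin n) (y : ∀ i, Bidual 𝕜 (E i)),
      (∀ m < i, ∃ x, y m = NormedSpace.inclusionInDoubleDual 𝕜 (E m) x) →
      ∀ φ : StrongDual 𝕜 F, ∃ ψ : StrongDual 𝕜 (E i), ∀ z : Bidual 𝕜 (E i),
        B (Function.update y i z) φ = z ψ

theorem isSuccessivelyWeakStarExtension_consExtension {n : ℕ}
    {E : Fin (n + 1) → Type*} [∀ i, NormedAddCommGroup (E i)] [∀ i, NormedSpace 𝕜 (E i)]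
    {F : Type*} [NormedAddCommGroup F] [NormedSpace 𝕜 F]
    {Λ : ContinuousMultilinearMap 𝕜 (fun i : Fin n => E i.succ) F →L[𝕜]
      ContinuousMultilinearMap 𝕜 (fun i : Fin n => Bidual 𝕜 (E i.succ)) (Bidual 𝕜 F)}
    (hΛ : ∀ A, IsSuccessivelyWeakStarExtension A (Λ A)) (A : ContinuousMultilinearMap 𝕜 E F) :
    IsSuccessivelyWeakStarExtension A
      (consExtension (D := fun i => Bidual 𝕜 (E i)) (extendToBidual 𝕜 (E 0) (StrongDual 𝕜 F))
        Λ A) := by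
  set B := consExtension (D := fun i => Bidual 𝕜 (E i))
    (extendToBidual 𝕜 (E 0) (StrongDual 𝕜 F)) Λ A
  have hB (y : ∀ i, Bidual 𝕜 (E i)) (φ : StrongDual 𝕜 F) :
      B y φ = y 0 (((Λ.comp A.curryLeft).flipMultilinear (Fin.tail y)).flip φ) := by
    rw [consExtension_apply, extendToBidual_apply]
  have hB₀ (y : ∀ i, Bidual 𝕜 (E i)) (x : E 0)
      (hx : y 0 = NormedSpace.inclusionInDoubleDual 𝕜 (E 0) x) :
      B y = Λ (A.curryLeft x) (Fin.tail y) := by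
    ext φ
    rw [hB, hx]
    rfl
  refine ⟨fun x => ?_, fun i y hy φ => ?_⟩
  · calc B (fun i => NormedSpace.inclusionInDoubleDual 𝕜 (E i) (x i))
        = Λ (A.curryLeft (x 0))
            (fun i => NormedSpace.inclusionInDoubleDual 𝕜 (E i.succ) (x i.succ)) :=
          hB₀ _ (x 0) rfl
      _ = NormedSpace.inclusionInDoubleDual 𝕜 F (A.curryLeft (x 0) (Fin.tail x)) :=
          (hΛ (A.curryLeft (x 0))).1 (Fin.tail x)
      _ = NormedSpace.inclusionInDoubleDual 𝕜 F (A x) := by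
          rw [ContinuousMultilinearMap.curryLeft_apply, Fin.cons_self_tail]
  · cases i using Fin.cases with
    | zero =>
      refine ⟨((Λ.comp A.curryLeft).flipMultilinear (Fin.tail y)).flip φ, fun z => ?_⟩
      rw [hB, Fin.tail_update_zero, Function.update_self]
    | succ i =>
      obtain ⟨x, hx⟩ := hy 0 i.succ_pos
      obtain ⟨ψ, hψ⟩ := (hΛ (A.curryLeft x)).2 i (Fin.tail y)
        (fun m hm => hy m.succ (Fin.succ_lt_succ_iff.2 hm)) φ
      refine ⟨ψ, fun z => ?_⟩
      rw [hB₀ _ x (by rw [Function.update_of_ne i.succ_ne_zero.symm, hx]), Fin.tail_update_succ,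
        ← hψ]

theorem exists_forall_isSuccessivelyWeakStarExtension (n : ℕ)
    (E : Fin n → Type*) [∀ i, NormedAddCommGroup (E i)] [∀ i, NormedSpace 𝕜 (E i)]
    (F : Type*) [NormedAddCommGroup F] [NormedSpace 𝕜 F] :
    ∃ Λ : ContinuousMultilinearMap 𝕜 E F →L[𝕜]
      ContinuousMultilinearMap 𝕜 (fun i => Bidual 𝕜 (E i)) (Bidual 𝕜 F),
      ∀ A, IsSuccessivelyWeakStarExtension A (Λ A) := by
  induction n with
  | zero =>
    refine ⟨(ContinuousLinearMap.compContinuousMultilinearMapL 𝕜 _ F (Bidual 𝕜 F)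
      (NormedSpace.inclusionInDoubleDual 𝕜 F)).comp
        (ContinuousMultilinearMap.compContinuousLinearMapL fun _ => 0),
      fun A => ⟨fun x => ?_, fun i => i.elim0⟩⟩
    rw [Subsingleton.elim x 0]
    rfl
  | succ n ih =>
    obtain ⟨Λ, hΛ⟩ := ih fun i => E i.succ
    exact ⟨_, isSuccessivelyWeakStarExtension_consExtension hΛ⟩

variable {n : ℕ} {E : Fin n → Type*} [∀ i, NormedAddCommGroup (E i)] [∀ i, NormedSpace 𝕜 (E i)]
  {F : Type*} [NormedAddCommGroup F] [NormedSpace 𝕜 F]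

theorem IsSuccessivelyWeakStarExtension.hasIteratedLim {A : ContinuousMultilinearMap 𝕜 E F}
    {B : ContinuousMultilinearMap 𝕜 (fun i => Bidual 𝕜 (E i)) (Bidual 𝕜 F)}
    (hAB : IsSuccessivelyWeakStarExtension A B) {y : ∀ i, Bidual 𝕜 (E i)}
    {l : ∀ i, Filter (E i)}
    (hl : ∀ i, Tendsto (bidualEmb 𝕜 (E i)) (l i) (𝓝 (StrongDual.toWeakDual (y i))))
    (is : List (Fin n)) (his : is.Pairwise (· < ·)) :
    HasIteratedLim l (fun x => bidualEmb 𝕜 F (A x)) is (fun x => StrongDual.toWeakDual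
      (B fun m => if m ∈ is then y m else NormedSpace.inclusionInDoubleDual 𝕜 (E m) (x m))) := by
  let mixed (js : List (Fin n)) (x : ∀ i, E i) (m : Fin n) : Bidual 𝕜 (E m) :=
    if m ∈ js then y m else NormedSpace.inclusionInDoubleDual 𝕜 (E m) (x m)
  change HasIteratedLim l _ is fun x => StrongDual.toWeakDual (B (mixed is x))
  induction is with
  | nil =>
    funext x
    simp only [mixed, List.not_mem_nil, if_false, hAB.1, bidualEmb]
  | cons i is ih =>
    obtain ⟨hlt, his⟩ := List.pairwise_cons.1 his
    refine ⟨_, ih his, fun x => ?_⟩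
    have hmixed_cons : mixed (i :: is) x = Function.update (mixed is x) i (y i) := by
      ext1 m
      rcases eq_or_ne m i with rfl | hne
      · simp [mixed]
      · simp [mixed, hne]
    have hmixed_update (t : E i) : mixed is (Function.update x i t) =
        Function.update (mixed is x) i (NormedSpace.inclusionInDoubleDual 𝕜 (E i) t) := by
      ext1 m
      rcases eq_or_ne m i with rfl | hne
      · simp [mixed, show m ∉ is from fun h => lt_irrefl m (hlt m h)]
      · simp [mixed, hne]
    simp only [hmixed_cons, hmixed_update]
    rw [tendsto_iff_forall_eval_tendsto_topDualPairing]
    intro φ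
    obtain ⟨ψ, hψ⟩ := hAB.2 i (mixed is x)
      (fun m hm => ⟨x m, if_neg fun h => (hlt m h).not_gt hm⟩) φ
    have hψlim := tendsto_iff_forall_eval_tendsto_topDualPairing.1 (hl i) ψ
    exact (hψlim.congr fun t => (hψ _).symm).trans_eq (congrArg 𝓝 (hψ (y i)).symm)

theorem exists_isAronBernerExtension (A : ContinuousMultilinearMap 𝕜 E F) :
    ∃ B, IsAronBernerExtension A B := by
  obtain ⟨Λ, hΛ⟩ := exists_forall_isSuccessivelyWeakStarExtension (𝕜 := 𝕜) n E F
  refine ⟨Λ A, 1, fun y l _ hl => ?_⟩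
  have h := (hΛ A).hasIteratedLim hl (List.ofFn (1 : Equiv.Perm (Fin n)))
    (List.pairwise_ofFn.2 fun i j hij => hij)
  simpa [List.mem_ofFn] using h

end Existence

section Transfer

variable {𝕜 : Type*} [RCLike 𝕜] {n : ℕ} {E : Fin n → Type*} [∀ i, NormedAddCommGroup (E i)]
  [∀ i, NormedSpace 𝕜 (E i)] {F : Type*} [NormedAddCommGroup F] [NormedSpace 𝕜 F]
  {A : ContinuousMultilinearMap 𝕜 E F}
  {B : ContinuousMultilinearMap 𝕜 (fun i => Bidual 𝕜 (E i)) (Bidual 𝕜 F)}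

theorem IsAronBernerExtension.apply_inclusionInDoubleDual (hB : IsAronBernerExtension A B)
    (x : ∀ i, E i) : B (fun i => NormedSpace.inclusionInDoubleDual 𝕜 (E i) (x i)) =
      NormedSpace.inclusionInDoubleDual 𝕜 F (A x) := by
  obtain ⟨σ, hσ⟩ := hB
  have h := (hσ (fun i => NormedSpace.inclusionInDoubleDual 𝕜 (E i) (x i)) (fun i => pure (x i))
    (fun i => inferInstance) (fun i => tendsto_pure_nhds _ _)).eq_of_pure x
  simp only [ite_self] at h
  exact StrongDual.toWeakDual.injective h

theorem IsAronBernerExtension.mem_of_isClosed (hB : IsAronBernerExtension A B) {ι : Type*}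
    {K : Set (ι → WeakDual 𝕜 (StrongDual 𝕜 F))} (hK : IsClosed K)
    {S : ∀ i, Set (ι → E i)} {L : ∀ i, Filter (ι → E i)} (hL : ∀ i, (L i).NeBot)
    (hS : ∀ i, S i ∈ L i)
    (hA : ∀ x : ∀ i, ι → E i, (∀ i, x i ∈ S i) →
      (fun j => bidualEmb 𝕜 F (A fun i => x i j)) ∈ K)
    {y : ∀ i, ι → Bidual 𝕜 (E i)}
    (hy : ∀ i j, Tendsto (fun x => bidualEmb 𝕜 (E i) (x j)) (L i)
      (𝓝 (StrongDual.toWeakDual (y i j)))) :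
    (fun j => StrongDual.toWeakDual (B fun i => y i j)) ∈ K := by
  obtain ⟨σ, hσ⟩ := hB
  choose x hx using fun i => (hL i).nonempty_of_mem (hS i)
  exact HasIteratedLim.mem_of_isClosed hK hL hS hA
    (fun j => hσ (fun i => y i j) _ (fun i => (hL i).map _)
      (fun i => tendsto_map'_iff.2 (hy i j))) hx

theorem IsAronBernerExtension.le_mul_prod (hB : IsAronBernerExtension A B) {ι : Type*}
    {μ : (ι → Bidual 𝕜 F) → ℝ}
    (hμ : LowerSemicontinuous fun w : ι → WeakDual 𝕜 (StrongDual 𝕜 F) =>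
      μ fun j => WeakDual.toStrongDual (w j))
    {ν : ∀ i, (ι → E i) → ℝ} (hν : ∀ i x, 0 ≤ ν i x) {C : ℝ} (hC : 0 ≤ C)
    (hA : ∀ x : ∀ i, ι → E i,
      μ (fun j => NormedSpace.inclusionInDoubleDual 𝕜 F (A fun i => x i j)) ≤ C * ∏ i, ν i (x i))
    {y : ∀ i, ι → Bidual 𝕜 (E i)} {c : Fin n → ℝ}
    (hy : ∀ i, ∀ r > c i, IsWeakStarApproximable (ν i) (y i) r) :
    μ (fun j => B fun i => y i j) ≤ C * ∏ i, c i := by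
  have hδ : ∀ δ > 0, μ (fun j => B fun i => y i j) ≤ C * ∏ i, (c i + δ) := by
    intro δ hδ
    choose L hL hlim hle using fun i => hy i (c i + δ) (lt_add_of_pos_right _ hδ)
    refine hB.mem_of_isClosed (lowerSemicontinuous_iff_isClosed_preimage.1 hμ (C * ∏ i, (c i + δ)))
      hL hle (fun x hx => (hA x).trans ?_) hlim
    gcongr with i
    · exact fun i _ => hν i (x i)
    · exact hx i
  have hlim : Tendsto (fun δ : ℝ => C * ∏ i, (c i + δ)) (𝓝[>] 0) (𝓝 (C * ∏ i, (c i + 0))) :=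
    (Continuous.tendsto (by fun_prop) _).mono_left nhdsWithin_le_nhds
  simp only [add_zero] at hlim
  exact ge_of_tendsto hlim (eventually_mem_nhdsWithin.mono hδ)

theorem IsAronBernerExtension.hasMultiType_iff {p : Fin n → ℝ} (hB : IsAronBernerExtension A B)
    (hp : ∀ i, 0 < p i) :
    HasMultiType p A ↔
      HasMultiType (𝕜 := 𝕜) (E := fun i => Bidual 𝕜 (E i)) (F := Bidual 𝕜 F) p B := by
  constructor <;> rintro ⟨C, hC, h⟩
  · refine ⟨C, hC, fun k y => hB.le_mul_prod (lowerSemicontinuous_radNorm 𝕜 k)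
      (fun i => lpSeqNorm_nonneg (p i)) hC.le (fun x => ?_)
      (fun i r hr => isWeakStarApproximable_lpSeqNorm (hp i) (y i) hr.le)⟩
    rw [radNorm_inclusionInDoubleDual]
    exact h k x
  · refine ⟨C, hC, fun k x => ?_⟩
    simpa only [hB.apply_inclusionInDoubleDual, lpSeqNorm_inclusionInDoubleDual,
      radNorm_inclusionInDoubleDual] using
      h k fun i j => NormedSpace.inclusionInDoubleDual 𝕜 (E i) (x i j)

theorem IsAronBernerExtension.hasMultiCotype_iff {q : ℝ} (hB : IsAronBernerExtension A B)
    (hq : 0 < q) :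
    HasMultiCotype q A ↔
      HasMultiCotype (𝕜 := 𝕜) (E := fun i => Bidual 𝕜 (E i)) (F := Bidual 𝕜 F) q B := by
  constructor <;> rintro ⟨M, hM, h⟩
  · refine ⟨M, hM, fun k y => hB.le_mul_prod (lowerSemicontinuous_lpSeqNorm 𝕜 hq k)
      (fun i => radNorm_nonneg 𝕜) hM.le (fun x => ?_)
      (fun i r hr => isWeakStarApproximable_radNorm (y i) hr)⟩
    rw [lpSeqNorm_inclusionInDoubleDual]
    exact h k x
  · refine ⟨M, hM, fun k x => ?_⟩
    simpa only [hB.apply_inclusionInDoubleDual, lpSeqNorm_inclusionInDoubleDual,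
      radNorm_inclusionInDoubleDual] using
      h k fun i j => NormedSpace.inclusionInDoubleDual 𝕜 (E i) (x i j)

theorem tfae_forall_exists_isAronBernerExtension {P : Prop}
    {Q : ContinuousMultilinearMap 𝕜 (fun i => Bidual 𝕜 (E i)) (Bidual 𝕜 F) → Prop}
    (hPQ : ∀ B, IsAronBernerExtension A B → (P ↔ Q B)) :
    [P, ∀ B, IsAronBernerExtension A B → Q B, ∃ B, IsAronBernerExtension A B ∧ Q B].TFAE := by
  tfae_have 1 → 2 := fun h B hB => (hPQ B hB).1 h
  tfae_have 2 → 3 := fun h => (exists_isAronBernerExtension A).imp fun B hB => ⟨hB, h B hB⟩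
  tfae_have 3 → 1 := fun ⟨B, hB, h⟩ => (hPQ B hB).2 h
  tfae_finish

end Transfer

end

theorem corollary4p2_general {𝕜 : Type*} [RCLike 𝕜] {n : ℕ}
    {E : Fin n → Type*} [∀ i, NormedAddCommGroup (E i)] [∀ i, NormedSpace 𝕜 (E i)]
    {F : Type*} [NormedAddCommGroup F] [NormedSpace 𝕜 F]
    (p : Fin n → ℝ) (hp : ∀ i, 0 < p i) (q : ℝ) (hq : 0 < q)
    (A : ContinuousMultilinearMap 𝕜 E F) :
    [HasMultiType p A,
      ∀ B : ContinuousMultilinearMap 𝕜 (fun i => Bidual 𝕜 (E i)) (Bidual 𝕜 F),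
        IsAronBernerExtension A B →
          HasMultiType (𝕜 := 𝕜) (E := fun i => Bidual 𝕜 (E i)) (F := Bidual 𝕜 F) p B,
      ∃ B : ContinuousMultilinearMap 𝕜 (fun i => Bidual 𝕜 (E i)) (Bidual 𝕜 F),
        IsAronBernerExtension A B ∧
          HasMultiType (𝕜 := 𝕜) (E := fun i => Bidual 𝕜 (E i)) (F := Bidual 𝕜 F) p B].TFAE ∧
    [HasMultiCotype q A,
      ∀ B : ContinuousMultilinearMap 𝕜 (fun i => Bidual 𝕜 (E i)) (Bidual 𝕜 F),
        IsAronBernerExtension A B →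
          HasMultiCotype (𝕜 := 𝕜) (E := fun i => Bidual 𝕜 (E i)) (F := Bidual 𝕜 F) q B,
      ∃ B : ContinuousMultilinearMap 𝕜 (fun i => Bidual 𝕜 (E i)) (Bidual 𝕜 F),
        IsAronBernerExtension A B ∧
          HasMultiCotype (𝕜 := 𝕜) (E := fun i => Bidual 𝕜 (E i)) (F := Bidual 𝕜 F) q B].TFAE :=
  ⟨tfae_forall_exists_isAronBernerExtension fun _ hB => hB.hasMultiType_iff hp,
    tfae_forall_exists_isAronBernerExtension fun _ hB => hB.hasMultiCotype_iff hq⟩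

theorem corollary4p2 {𝕜 : Type*} [RCLike 𝕜] {n : ℕ} (hn : 2 ≤ n)
    {E : Fin n → Type*} [∀ i, NormedAddCommGroup (E i)] [∀ i, NormedSpace 𝕜 (E i)]
    [∀ i, CompleteSpace (E i)]
    {F : Type*} [NormedAddCommGroup F] [NormedSpace 𝕜 F] [CompleteSpace F]
    (p : Fin n → ℝ) (hp : IsProperType p) (q : ℝ) (hq : IsProperCotype n q)
    (A : ContinuousMultilinearMap 𝕜 E F) :
    [HasMultiType p A,
      ∀ B : ContinuousMultilinearMap 𝕜 (fun i => Bidual 𝕜 (E i)) (Bidual 𝕜 F),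
        IsAronBernerExtension A B →
          HasMultiType (𝕜 := 𝕜) (E := fun i => Bidual 𝕜 (E i)) (F := Bidual 𝕜 F) p B,
      ∃ B : ContinuousMultilinearMap 𝕜 (fun i => Bidual 𝕜 (E i)) (Bidual 𝕜 F),
        IsAronBernerExtension A B ∧
          HasMultiType (𝕜 := 𝕜) (E := fun i => Bidual 𝕜 (E i)) (F := Bidual 𝕜 F) p B].TFAE ∧
    [HasMultiCotype q A,
      ∀ B : ContinuousMultilinearMap 𝕜 (fun i => Bidual 𝕜 (E i)) (Bidual 𝕜 F),
        IsAronBernerExtension A B →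
          HasMultiCotype (𝕜 := 𝕜) (E := fun i => Bidual 𝕜 (E i)) (F := Bidual 𝕜 F) q B,
      ∃ B : ContinuousMultilinearMap 𝕜 (fun i => Bidual 𝕜 (E i)) (Bidual 𝕜 F),
        IsAronBernerExtension A B ∧
          HasMultiCotype (𝕜 := 𝕜) (E := fun i => Bidual 𝕜 (E i)) (F := Bidual 𝕜 F) q B].TFAE :=
  corollary4p2_general p hp.1 q hq.1 A
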